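/- Let $d=2^n$, let $\mathcal G$ be a set of $n$-qubit Pauli strings (tensor products of $I,X,Y,Z$), let $\mathfrak g=\langle i\mathcal G\rangle_{\rm Lie}$ be the smallest real Lie algebra of $d\times d$ matrices containing $i\mathcal G$, and let $G=\exp\mathfrak g\subset \mathbb U(d)$ be the corresponding compact connected Lie group (the smallest closed subgroup of $\mathbb U(d)$ containing $\exp A$ for all $A\in\mathfrak g$), with Haar probability measure $\mu_G$. The commutator graph has the $4^n$ Pauli strings as vertices, and $p,q$ are joined by an edge if $[p,X]$ is a nonzero multiple of $q$ for some $X\in\mathcal G$; $C_Q$ denotes the connected component of $Q$. A linear symmetry is an operator $L$ with $[L,U]=0$ for all $U\in G$. Put $\langle\langle A|B\rangle\rangle=\operatorname{tr}[A^\dagger B]$ and $\mathsf T^{(1)}_G=\sum_j|L_j\rangle\rangle\langle\langle L_j|$, where $\{L_j\}_j$ are the Pauli strings that are linear symmetries. Then for all Pauli strings $P,Q,R,S$ $$\mathbb E_{U\sim\mu_G}\operatorname{tr}\big[PUQU^\dagger RUSU^\dagger\big]=d^{-1}\,\langle\langle RP|\mathsf T^{(1)}_G|SQ\rangle\rangle\left(1-\frac{2\,|\{T\in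 C_Q:\{P,T\}=0\}|}{|C_Q|}\right),$$ where $\{P,T\}=PT+TP$. This expression is zero unless there exists a linear symmetry $L$ such that $RP$ and $QS$ are both proportional to $L$. -/

import Mathlib

open MeasureTheory

attribute [local instance] LieRing.ofAssociativeRing

/-- The four single-qubit Pauli labels. -/
inductive Pauli
  | I
  | X
  | Y
  | Z
  deriving DecidableEq

instance Pauli.instFintype : Fintype Pauli where
  elems := {Pauli.I, Pauli.X, Pauli.Y, Pauli.Z}
  complete := by
    intro s
    cases s <;> simp

/-- The `2 × 2` Pauli matrix with a given label. -/
def Pauli.toMatrix : Pauli → Matrix (Fin 2) (Fin 2) ℂ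
  | Pauli.I => 1
  | Pauli.X => !![0, 1; 1, 0]
  | Pauli.Y => !![0, -Complex.I; Complex.I, 0]
  | Pauli.Z => !![1, 0; 0, -1]

/-- The labels of the `4 ^ n` Pauli strings on `n` qubits. -/
abbrev PauliString (n : ℕ) := Fin n → Pauli

/-- The computational basis of `n` qubits; it has `d = 2 ^ n` elements. -/
abbrev QubitBasis (n : ℕ) := Fin n → Fin 2

/-- Operators on the Hilbert space of `n` qubits, as matrices in the computational basis. -/
abbrev QubitOp (n : ℕ) := Matrix (QubitBasis n) (QubitBasis n) ℂ

/-- The Pauli string `p₁ ⊗ ⋯ ⊗ pₙ` as an operator (entrywise form of the Kronecker product). -/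
def PauliString.op {n : ℕ} (p : PauliString n) : QubitOp n :=
  Matrix.of fun a b => ∏ k, (p k).toMatrix (a k) (b k)

theorem PauliString.op_mul_apply {n : ℕ} (p q : PauliString n) (a b : QubitBasis n) :
    (p.op * q.op) a b = ∏ k, ((p k).toMatrix * (q k).toMatrix) (a k) (b k) := by
  simp only [Matrix.mul_apply, PauliString.op, Matrix.of_apply, ← Finset.prod_mul_distrib]
  exact (Fintype.prod_sum fun k c => (p k).toMatrix (a k) c * (q k).toMatrix c (b k)).symm

theorem PauliString.op_mul_self {n : ℕ} (p : PauliString n) : p.op * p.op = 1 := by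
  have h : ∀ s : Pauli, s.toMatrix * s.toMatrix = 1 := by
    intro s
    cases s <;> ext i j <;> fin_cases i <;> fin_cases j <;>
      simp [Pauli.toMatrix, Matrix.mul_apply, Fin.sum_univ_two]
  ext a b
  rw [PauliString.op_mul_apply]
  simp only [h, Matrix.one_apply, Finset.prod_boole, Finset.mem_univ, true_implies, funext_iff]

/-- Two Pauli strings commute or anticommute. -/
theorem PauliString.op_comm_or {n : ℕ} (p q : PauliString n) :
    p.op * q.op = q.op * p.op ∨ p.op * q.op = -(q.op * p.op) := by
  have h : ∀ s t : Pauli, ∃ e : ℂ, (e = 1 ∨ e = -1) ∧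
      s.toMatrix * t.toMatrix = e • (t.toMatrix * s.toMatrix) := by
    intro s t
    cases s <;> cases t <;>
      first
      | (refine ⟨1, Or.inl rfl, ?_⟩
         ext i j
         fin_cases i <;> fin_cases j <;>
           simp [Pauli.toMatrix, Matrix.mul_apply, Fin.sum_univ_two] <;> done)
      | (refine ⟨-1, Or.inr rfl, ?_⟩
         ext i j
         fin_cases i <;> fin_cases j <;>
           simp [Pauli.toMatrix, Matrix.mul_apply, Fin.sum_univ_two])
  choose e he hmul using h
  have hprod : p.op * q.op = (∏ k, e (p k) (q k)) • (q.op * p.op) := by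
    ext a b
    rw [Matrix.smul_apply, PauliString.op_mul_apply, PauliString.op_mul_apply, smul_eq_mul,
      ← Finset.prod_mul_distrib]
    refine Finset.prod_congr rfl fun k _ => ?_
    rw [hmul, Matrix.smul_apply, smul_eq_mul]
  have hsign : (∏ k, e (p k) (q k)) = 1 ∨ (∏ k, e (p k) (q k)) = -1 :=
    Finset.prod_induction _ (fun x : ℂ => x = 1 ∨ x = -1)
      (by rintro x y (rfl | rfl) (rfl | rfl) <;> simp) (Or.inl rfl) (fun k _ => he _ _)
  rcases hsign with h1 | h1
  · left
    rw [hprod, h1, one_smul]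
  · right
    rw [hprod, h1, neg_one_smul]

theorem PauliString.op_ne_zero {n : ℕ} (p : PauliString n) : p.op ≠ 0 := by
  intro h
  have := p.op_mul_self
  rw [h, zero_mul] at this
  exact zero_ne_one this

/-- The edge relation of the commutator graph: `[p, X]` is a nonzero multiple of `q` for some
generator `X`. -/
def CommutatorEdge {n : ℕ} (𝒢 : Set (PauliString n)) (p q : PauliString n) : Prop :=
  ∃ X ∈ 𝒢, ∃ c : ℂ, c ≠ 0 ∧ p.op * X.op - X.op * p.op = c • q.op

theorem CommutatorEdge.anticomm {n : ℕ} {p q X : PauliString n} {c : ℂ} (hc : c ≠ 0)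
    (h : p.op * X.op - X.op * p.op = c • q.op) : X.op * p.op = -(p.op * X.op) := by
  rcases X.op_comm_or p with h1 | h1
  · rw [h1, sub_self] at h
    exact absurd h.symm (smul_ne_zero hc q.op_ne_zero)
  · exact h1

/-- The commutator graph of a set `𝒢` of generators, on the set of all Pauli strings. -/
def commutatorGraph {n : ℕ} (𝒢 : Set (PauliString n)) : SimpleGraph (PauliString n) where
  Adj p q := CommutatorEdge 𝒢 p q
  symm := ⟨by
    rintro p q ⟨X, hX, c, hc, h⟩
    have ha := CommutatorEdge.anticomm hc h
    refine ⟨X, hX, c⁻¹ * 4, mul_ne_zero (inv_ne_zero hc) (by norm_num), ?_⟩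
    have hq : q.op = (c⁻¹ * 2) • (p.op * X.op) := by
      have : q.op = c⁻¹ • (c • q.op) := by rw [smul_smul, inv_mul_cancel₀ hc, one_smul]
      rw [this, ← h, ha, mul_smul]
      congr 1
      rw [sub_neg_eq_add, two_smul]
    have h1 : p.op * X.op * X.op = p.op := by rw [mul_assoc, X.op_mul_self, mul_one]
    have h2 : X.op * (p.op * X.op) = -p.op := by rw [← mul_assoc, ha, neg_mul, h1]
    rw [hq, smul_mul_assoc, mul_smul_comm, h1, h2, smul_neg, sub_neg_eq_add, ← add_smul]
    congr 1
    ring⟩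
  loopless := ⟨by
    rintro p ⟨X, hX, c, hc, h⟩
    have ha := CommutatorEdge.anticomm hc h
    rw [ha, sub_neg_eq_add, ← two_smul ℂ] at h
    have h1 : p.op * p.op * X.op = X.op := by rw [p.op_mul_self, one_mul]
    have h2 : (2 : ℂ) • X.op = c • (1 : QubitOp n) := by
      have := congrArg (fun M => p.op * M) h
      simpa only [mul_smul_comm, ← mul_assoc, h1, p.op_mul_self, one_mul] using this
    have h3 : X.op = (2⁻¹ * c) • (1 : QubitOp n) := by
      rw [mul_smul, ← h2, smul_smul, inv_mul_cancel₀ two_ne_zero, one_smul]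
    rw [h3, smul_mul_assoc, mul_smul_comm, one_mul, mul_one, eq_neg_iff_add_eq_zero,
      ← two_smul ℂ, smul_smul, smul_eq_zero] at ha
    rcases ha with ha | ha
    · simp [hc] at ha
    · exact p.op_ne_zero ha⟩

/-- The connected component `C_Q` of a Pauli string `Q` in the commutator graph. -/
def graphComponent {n : ℕ} (𝒢 : Set (PauliString n)) (Q : PauliString n) :
    Set (PauliString n) :=
  {T | (commutatorGraph 𝒢).Reachable Q T}

/-- The dynamical Lie algebra `⟨i𝒢⟩_Lie`: the smallest real Lie algebra of operators that
contains `i X` for every generator `X`. -/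
noncomputable def dynamicalLieAlgebra {n : ℕ} (𝒢 : Set (PauliString n)) :
    LieSubalgebra ℝ (QubitOp n) :=
  LieSubalgebra.lieSpan ℝ (QubitOp n) ((fun X : PauliString n => Complex.I • X.op) '' 𝒢)

/-- The compact connected Lie group `G` of the dynamics: the smallest closed subgroup of the
unitary group that contains `exp A` for every `A` in the dynamical Lie algebra. -/
noncomputable def dynamicalGroup {n : ℕ} (𝒢 : Set (PauliString n)) :
    Subgroup (Matrix.unitaryGroup (QubitBasis n) ℂ) :=
  (Subgroup.closure {U : Matrix.unitaryGroup (QubitBasis n) ℂ |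
    ∃ A ∈ dynamicalLieAlgebra 𝒢, (U : QubitOp n) = NormedSpace.exp A}).topologicalClosure

/-- The group `G` is compact, so it carries a Haar probability measure. -/
instance dynamicalGroup.compactSpace {n : ℕ} (𝒢 : Set (PauliString n)) :
    CompactSpace (dynamicalGroup 𝒢) := by
  have hK : IsCompact (Set.pi Set.univ fun _ : QubitBasis n =>
      Set.pi Set.univ fun _ : QubitBasis n => Metric.closedBall (0 : ℂ) 1) :=
    isCompact_univ_pi fun _ => isCompact_univ_pi fun _ => isCompact_closedBall 0 1
  have hcl : IsClosed {U : QubitOp n | U ∈ Matrix.unitaryGroup (QubitBasis n) ℂ} := by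
    have : {U : QubitOp n | U ∈ Matrix.unitaryGroup (QubitBasis n) ℂ} =
        {U : QubitOp n | U * star U = 1} := by
      ext U
      exact Matrix.mem_unitaryGroup_iff
    rw [this]
    exact isClosed_eq (continuous_id.mul continuous_id.star) continuous_const
  have hcomp : IsCompact {U : QubitOp n | U ∈ Matrix.unitaryGroup (QubitBasis n) ℂ} := by
    refine IsCompact.of_isClosed_subset (X := QubitBasis n → QubitBasis n → ℂ) hK hcl ?_
    intro U hU i _ j _
    rw [mem_closedBall_zero_iff]
    exact entry_norm_bound_of_unitary hU i j
  have : CompactSpace (Matrix.unitaryGroup (QubitBasis n) ℂ) :=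
    isCompact_iff_compactSpace.mp hcomp
  exact isCompact_iff_compactSpace.mp
    (Subgroup.isClosed_topologicalClosure _).isCompact

/-- A linear symmetry of `G`: an operator that commutes with every element of `G`. -/
def IsLinearSymmetry {n : ℕ} (𝒢 : Set (PauliString n)) (L : QubitOp n) : Prop :=
  ∀ U ∈ dynamicalGroup 𝒢, L * (U : QubitOp n) = (U : QubitOp n) * L

/-- The Hilbert-Schmidt pairing `⟨⟨A|B⟩⟩ = tr[A† B]`. -/
def hsInner {n : ℕ} (A B : QubitOp n) : ℂ :=
  (A.conjTranspose * B).trace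

open Classical in
/-- The superoperator `T⁽¹⁾ = ∑ⱼ |Lⱼ⟩⟩⟨⟨Lⱼ|`, where the `Lⱼ` are the Pauli strings (not
normalized) that are linear symmetries of `G`. -/
noncomputable def linearTwirl {n : ℕ} (𝒢 : Set (PauliString n)) :
    QubitOp n →ₗ[ℂ] QubitOp n where
  toFun B := ∑ L : PauliString n with IsLinearSymmetry 𝒢 L.op, hsInner L.op B • L.op
  map_add' A B := by
    simp only [hsInner, Matrix.mul_add, Matrix.trace_add, add_smul, Finset.sum_add_distrib]
  map_smul' c B := by
    simp only [hsInner, Matrix.mul_smul, Matrix.trace_smul, smul_eq_mul, mul_smul,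
      Finset.smul_sum, RingHom.id_apply]

/-! Write F(A, B) for the average of tr[P U A U† R U B U†]. Right invariance of Haar measure gives
F(V A V†, V B V†) = F(A, B) for V in G, and for each generator X two choices of V suffice. The
choice V = iX forces F(Q, S) = 0 when X commutes with exactly one of Q and S. Only the case where L
= QS commutes with all generators survives, and then S = QL. The choice V = exp(iπX/4) sends a
string T that anticommutes with X to iXT, a neighbour of T up to sign, so F(T, TL) is constant on
C_Q (`integral_correlator_of_mem_graphComponent`).

Hence |C_Q| F(Q, S) is the sum of F(T, TL) over the component. Since ∑ T ⊗ T commutes with every U ⊗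
U (`commute_sum_kronecker_kroneckerSum`, `commute_kronecker_of_mem`), the summed integrand does not
depend on U and equals ∑ tr[P T R T L]. Moving T past P costs a sign exactly when they anticommute,
and T L T = Q L Q on the component, so each term is ± tr[P R S Q]. Finally T⁽¹⁾ multiplies symmetric
strings by d and kills the others, which identifies this trace with the pairing in the formula. -/

/-! ### Products, traces and adjoints of Pauli strings -/

/-- The label of the product of two single-qubit Pauli matrices, up to phase. -/
def Pauli.mul : Pauli → Pauli → Pauli
  | I, t => t
  | s, I => s
  | X, X => I
  | Y, Y => I
  | Z, Z => I
  | X, Y => Z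
  | Y, X => Z
  | X, Z => Y
  | Z, X => Y
  | Y, Z => X
  | Z, Y => X

theorem Pauli.mul_mul_cancel (s t : Pauli) : s.mul (s.mul t) = t := by
  cases s <;> cases t <;> rfl

theorem Pauli.exists_toMatrix_mul (s t : Pauli) :
    ∃ c : ℂ, c ≠ 0 ∧ s.toMatrix * t.toMatrix = c • (s.mul t).toMatrix := by
  have key : ∃ c : ℂ, (c = 1 ∨ c = Complex.I ∨ c = -Complex.I) ∧
      s.toMatrix * t.toMatrix = c • (s.mul t).toMatrix := by
    cases s <;> cases t <;>
      first
      | (refine ⟨1, Or.inl rfl, ?_⟩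
         ext i j
         fin_cases i <;> fin_cases j <;>
           simp [Pauli.toMatrix, Pauli.mul, Matrix.mul_apply, Fin.sum_univ_two] <;> done)
      | (refine ⟨Complex.I, Or.inr (Or.inl rfl), ?_⟩
         ext i j
         fin_cases i <;> fin_cases j <;>
           simp [Pauli.toMatrix, Pauli.mul, Matrix.mul_apply, Fin.sum_univ_two] <;> done)
      | (refine ⟨-Complex.I, Or.inr (Or.inr rfl), ?_⟩
         ext i j
         fin_cases i <;> fin_cases j <;>
           simp [Pauli.toMatrix, Pauli.mul, Matrix.mul_apply, Fin.sum_univ_two])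
  obtain ⟨c, hc, h⟩ := key
  refine ⟨c, ?_, h⟩
  rcases hc with rfl | rfl | rfl <;> simp

theorem Pauli.trace_mul (s t : Pauli) :
    (s.toMatrix * t.toMatrix).trace = if s = t then 2 else 0 := by
  cases s <;> cases t <;>
    simp [Pauli.toMatrix, Matrix.trace, Fin.sum_univ_two, one_add_one_eq_two]

theorem Pauli.conjTranspose_toMatrix (s : Pauli) : s.toMatrix.conjTranspose = s.toMatrix := by
  cases s <;> ext i j <;> fin_cases i <;> fin_cases j <;> simp [Pauli.toMatrix]

namespace PauliString

variable {n : ℕ}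

/-- The label of the product of two Pauli strings, up to phase. -/
def mul (p q : PauliString n) : PauliString n := fun k => (p k).mul (q k)

theorem mul_mul_cancel (p q : PauliString n) : p.mul (p.mul q) = q :=
  funext fun _ => Pauli.mul_mul_cancel _ _

theorem exists_op_mul (p q : PauliString n) :
    ∃ c : ℂ, c ≠ 0 ∧ p.op * q.op = c • (p.mul q).op := by
  choose c hc h using Pauli.exists_toMatrix_mul
  refine ⟨∏ k, c (p k) (q k), Finset.prod_ne_zero_iff.mpr fun k _ => hc _ _, ?_⟩
  ext a b
  simp only [op_mul_apply, h, Matrix.smul_apply, smul_eq_mul, Finset.prod_mul_distrib]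
  rfl

theorem trace_op_mul (p q : PauliString n) :
    (p.op * q.op).trace = if p = q then 2 ^ n else 0 := by
  have h : (p.op * q.op).trace = ∏ k, ((p k).toMatrix * (q k).toMatrix).trace := by
    simp only [Matrix.trace, Matrix.diag_apply, op_mul_apply]
    exact (Fintype.prod_sum fun k c => ((p k).toMatrix * (q k).toMatrix) c c).symm
  rw [h]
  simp only [Pauli.trace_mul]
  split_ifs with hpq
  · subst hpq
    simp
  · obtain ⟨k, hk⟩ := Function.ne_iff.mp hpq
    exact Finset.prod_eq_zero (Finset.mem_univ k) (if_neg hk)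

theorem conjTranspose_op (p : PauliString n) : p.op.conjTranspose = p.op := by
  ext a b
  have h (k : Fin n) : star ((p k).toMatrix (b k) (a k)) = (p k).toMatrix (a k) (b k) :=
    congrFun₂ (Pauli.conjTranspose_toMatrix (p k)) (a k) (b k)
  simp only [Matrix.conjTranspose_apply, op, Matrix.of_apply, star_prod, h]

theorem hsInner_op (p : PauliString n) (B : QubitOp n) : hsInner p.op B = (p.op * B).trace := by
  rw [hsInner, conjTranspose_op]

/-- For anticommuting strings `i p q` is a string up to sign. -/
theorem exists_I_smul_mul {p q : PauliString n} (h : p.op * q.op = -(q.op * p.op)) :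
    ∃ e : ℂ, e * e = 1 ∧ Complex.I • (p.op * q.op) = e • (p.mul q).op := by
  obtain ⟨c, -, hm⟩ := exists_op_mul p q
  refine ⟨Complex.I * c, ?_, by rw [hm, smul_smul]⟩
  -- Anticommutation makes pq square to −1, so its phase c has c² = −1 and ic squares to 1.
  have h1 : (p.op * q.op) * (p.op * q.op) = -1 := by
    calc (p.op * q.op) * (p.op * q.op) = p.op * (q.op * p.op) * q.op := by noncomm_ring
      _ = p.op * (-(p.op * q.op)) * q.op := by rw [h, neg_neg]
      _ = -((p.op * p.op) * (q.op * q.op)) := by noncomm_ring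
      _ = -1 := by rw [op_mul_self, op_mul_self, one_mul]
  rw [hm, smul_mul_smul_comm, op_mul_self] at h1
  have h2 := congrFun₂ h1 0 0
  simp only [Matrix.smul_apply, Matrix.neg_apply, Matrix.one_apply_eq, smul_eq_mul, mul_one] at h2
  linear_combination (-1 : ℂ) * h2 + c * c * Complex.I_mul_I

end PauliString

/-! ### Neighbours in the commutator graph -/

section CommutatorGraph

variable {n : ℕ} {𝒢 : Set (PauliString n)}

theorem commutatorGraph_adj_mul {X p : PauliString n} (hX : X ∈ 𝒢)
    (h : X.op * p.op = -(p.op * X.op)) : (commutatorGraph 𝒢).Adj p (X.mul p) := by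
  obtain ⟨c, hc, hm⟩ := X.exists_op_mul p
  refine ⟨X, hX, -2 * c, mul_ne_zero (by norm_num) hc, ?_⟩
  rw [mul_smul, ← hm, h]
  module

/-- A neighbour of `p` is `i X p`, up to sign, for a generator `X` that anticommutes with `p`. -/
theorem exists_of_commutatorGraph_adj {p q : PauliString n} (h : (commutatorGraph 𝒢).Adj p q) :
    ∃ X ∈ 𝒢, X.op * p.op = -(p.op * X.op) ∧
      ∃ e : ℂ, e * e = 1 ∧ q.op = e • Complex.I • (X.op * p.op) := by
  obtain ⟨X, hX, c, hc, h⟩ := h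
  have ha := CommutatorEdge.anticomm hc h
  refine ⟨X, hX, ha, ?_⟩
  obtain ⟨e, he, hm⟩ := PauliString.exists_I_smul_mul ha
  have hq : q = X.mul p := by
    by_contra hne
    have h3 : c • q.op = (2 * Complex.I * e) • (X.mul p).op := by
      rw [mul_smul, ← hm, ← h, ha, smul_smul,
        show 2 * Complex.I * Complex.I = (-2 : ℂ) by rw [mul_assoc, Complex.I_mul_I]; ring]
      module
    -- Distinct strings are trace-orthogonal, so pairing with q isolates c ≠ 0 on the left and gives
    -- 0 on the right.
    have h4 := congrArg (fun M => (q.op * M).trace) h3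
    simp only [mul_smul_comm, Matrix.trace_smul, PauliString.trace_op_mul, if_neg hne] at h4
    simp [hc] at h4
  exact ⟨e, he, by rw [hm, smul_smul, he, one_smul, hq]⟩

end CommutatorGraph

/-! ### Commutants of the group on two copies -/

section TwoCopies

open scoped Kronecker

variable {n : ℕ} {𝒢 : Set (PauliString n)}

/-- A ↦ A ⊗ 1 is a continuous ring homomorphism, and these commute with the exponential series. -/
theorem exp_kronecker_one {m : Type*} [Fintype m] [DecidableEq m] (A : Matrix m m ℂ) :
    NormedSpace.exp (A ⊗ₖ (1 : Matrix m m ℂ)) = NormedSpace.exp A ⊗ₖ (1 : Matrix m m ℂ) := by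
  open scoped Matrix.Norms.Operator in
  let f : Matrix m m ℂ →+* Matrix (m × m) (m × m) ℂ :=
    { toFun := fun A => A ⊗ₖ (1 : Matrix m m ℂ)
      map_one' := Matrix.one_kronecker_one
      map_mul' := fun A B => by rw [← Matrix.mul_kronecker_mul, one_mul]
      map_zero' := Matrix.zero_kronecker _
      map_add' := fun A B => Matrix.add_kronecker _ _ _ }
  have hf : Continuous f := by
    refine continuous_matrix fun i j => ?_
    exact (continuous_id.matrix_elem _ _).mul continuous_const
  exact (NormedSpace.map_exp f hf A).symm

theorem exp_one_kronecker {m : Type*} [Fintype m] [DecidableEq m] (A : Matrix m m ℂ) :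
    NormedSpace.exp ((1 : Matrix m m ℂ) ⊗ₖ A) = (1 : Matrix m m ℂ) ⊗ₖ NormedSpace.exp A := by
  open scoped Matrix.Norms.Operator in
  let f : Matrix m m ℂ →+* Matrix (m × m) (m × m) ℂ :=
    { toFun := fun A => (1 : Matrix m m ℂ) ⊗ₖ A
      map_one' := Matrix.one_kronecker_one
      map_mul' := fun A B => by rw [← Matrix.mul_kronecker_mul, one_mul]
      map_zero' := Matrix.kronecker_zero _
      map_add' := fun A B => Matrix.kronecker_add _ _ _ }
  have hf : Continuous f := by
    refine continuous_matrix fun i j => ?_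
    exact continuous_const.mul (continuous_id.matrix_elem _ _)
  exact (NormedSpace.map_exp f hf A).symm

/-- The action of a Lie algebra element on two copies of the system. -/
def kroneckerSum {m : Type*} [DecidableEq m] (A : Matrix m m ℂ) : Matrix (m × m) (m × m) ℂ :=
  A ⊗ₖ (1 : Matrix m m ℂ) + (1 : Matrix m m ℂ) ⊗ₖ A

theorem exp_kroneckerSum {m : Type*} [Fintype m] [DecidableEq m] (A : Matrix m m ℂ) :
    NormedSpace.exp (kroneckerSum A) = NormedSpace.exp A ⊗ₖ NormedSpace.exp A := by
  have hc : Commute (A ⊗ₖ (1 : Matrix m m ℂ)) ((1 : Matrix m m ℂ) ⊗ₖ A) := by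
    rw [commute_iff_eq, ← Matrix.mul_kronecker_mul, ← Matrix.mul_kronecker_mul]
    simp
  rw [kroneckerSum, Matrix.exp_add_of_commute _ _ hc, exp_kronecker_one, exp_one_kronecker,
    ← Matrix.mul_kronecker_mul, one_mul, mul_one]

/-- An operator on two copies that commutes with the generators commutes with the dynamical Lie
algebra. -/
theorem commute_kroneckerSum_of_mem
    {K : Matrix (QubitBasis n × QubitBasis n) (QubitBasis n × QubitBasis n) ℂ}
    (hK : ∀ X ∈ 𝒢, Commute K (kroneckerSum X.op)) {A : QubitOp n}
    (hA : A ∈ dynamicalLieAlgebra 𝒢) : Commute K (kroneckerSum A) := by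
  have hsmul (c : ℂ) (A : QubitOp n) : kroneckerSum (c • A) = c • kroneckerSum A := by
    simp [kroneckerSum, Matrix.smul_kronecker, Matrix.kronecker_smul]
  induction hA using LieSubalgebra.lieSpan_induction with
  | mem _ h =>
    obtain ⟨X, hX, rfl⟩ := h
    simp only [hsmul]
    exact (hK X hX).smul_right _
  | zero => simp [kroneckerSum]
  | add A B _ _ hA hB =>
    have : kroneckerSum (A + B) = kroneckerSum A + kroneckerSum B := by
      simp only [kroneckerSum, Matrix.add_kronecker, Matrix.kronecker_add]
      abel
    rw [this]
    exact hA.add_right hB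
  | smul a A _ hA =>
    have : kroneckerSum (a • A) = a • kroneckerSum A := by
      simp [kroneckerSum, Matrix.smul_kronecker, Matrix.kronecker_smul]
    rw [this]
    exact hA.smul_right _
  | lie A B _ _ hA hB =>
    -- The mixed terms A ⊗ B and B ⊗ A cancel in the bracket.
    have : kroneckerSum ⁅A, B⁆ =
        kroneckerSum A * kroneckerSum B - kroneckerSum B * kroneckerSum A := by
      simp only [kroneckerSum, Ring.lie_def, mul_add, add_mul, ← Matrix.mul_kronecker_mul,
        one_mul, mul_one, sub_eq_add_neg, Matrix.add_kronecker, Matrix.kronecker_add,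
        ← neg_one_smul ℂ (B * A), Matrix.smul_kronecker, Matrix.kronecker_smul]
      module
    rw [this]
    exact (hA.mul_right hB).sub_right (hB.mul_right hA)

/-- An operator on two copies that commutes with the generators commutes with `U ⊗ U` for every
`U` in the dynamical group. -/
theorem commute_kronecker_of_mem
    {K : Matrix (QubitBasis n × QubitBasis n) (QubitBasis n × QubitBasis n) ℂ}
    (hK : ∀ X ∈ 𝒢, Commute K (kroneckerSum X.op)) {U : Matrix.unitaryGroup (QubitBasis n) ℂ}
    (hU : U ∈ dynamicalGroup 𝒢) : Commute K ((U : QubitOp n) ⊗ₖ (U : QubitOp n)) := by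
  -- The unitaries U for which U ⊗ U commutes with K form a closed subgroup, so only exponentials
  -- need checking.
  let H : Subgroup (Matrix.unitaryGroup (QubitBasis n) ℂ) :=
    { carrier := {U | Commute K ((U : QubitOp n) ⊗ₖ (U : QubitOp n))}
      one_mem' := by
        simp
      mul_mem' := fun {U V} hU hV => by
        have h := Commute.mul_right hU hV
        rwa [← Matrix.mul_kronecker_mul] at h
      inv_mem' := fun {U} hU => by
        have h1 : ((U : QubitOp n) ⊗ₖ (U : QubitOp n)) *
            (((U⁻¹ : Matrix.unitaryGroup (QubitBasis n) ℂ) : QubitOp n) ⊗ₖ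
              ((U⁻¹ : Matrix.unitaryGroup (QubitBasis n) ℂ) : QubitOp n)) = 1 := by
          rw [← Matrix.mul_kronecker_mul, ← Submonoid.coe_mul, mul_inv_cancel, Submonoid.coe_one,
            Matrix.one_kronecker_one]
        let u : (Matrix (QubitBasis n × QubitBasis n) (QubitBasis n × QubitBasis n) ℂ)ˣ :=
          ⟨_, _, h1, mul_eq_one_comm.mp h1⟩
        exact Commute.units_inv_right (u := u) hU }
  have hcl : IsClosed (H : Set (Matrix.unitaryGroup (QubitBasis n) ℂ)) := by
    have hc : Continuous fun U : Matrix.unitaryGroup (QubitBasis n) ℂ =>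
        (U : QubitOp n) ⊗ₖ (U : QubitOp n) := by
      refine continuous_matrix fun i j => ?_
      exact (continuous_subtype_val.matrix_elem _ _).mul (continuous_subtype_val.matrix_elem _ _)
    exact isClosed_eq (continuous_const.mul hc) (hc.mul continuous_const)
  refine Subgroup.topologicalClosure_minimal _ ?_ hcl hU
  rw [Subgroup.closure_le]
  rintro V ⟨A, hA, hV⟩
  change Commute K _
  rw [hV, ← exp_kroneckerSum]
  open scoped Matrix.Norms.Operator in
  exact (commute_kroneckerSum_of_mem hK hA).exp_right

/-- An operator that commutes with the generators is a linear symmetry. -/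
theorem isLinearSymmetry_of_commute {L : QubitOp n} (hL : ∀ X ∈ 𝒢, Commute L X.op) :
    IsLinearSymmetry 𝒢 L := by
  intro U hU
  -- One copy reduces to two by taking K = L ⊗ 1; the second factor U is then cancelled by 1 ⊗ U†.
  have h : Commute (L ⊗ₖ (1 : QubitOp n)) ((U : QubitOp n) ⊗ₖ (U : QubitOp n)) := by
    refine commute_kronecker_of_mem (fun X hX => ?_) hU
    rw [commute_iff_eq, kroneckerSum, mul_add, add_mul]
    simp only [← Matrix.mul_kronecker_mul, one_mul, mul_one, (hL X hX).eq]
  have h2 := congrArg (· * ((1 : QubitOp n) ⊗ₖ star (U : QubitOp n))) h.eq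
  simp only [← Matrix.mul_kronecker_mul, one_mul, mul_one,
    Matrix.mem_unitaryGroup_iff.mp U.2] at h2
  ext i j
  have h3 := congrFun₂ h2 (i, 0) (j, 0)
  simpa [Matrix.kronecker_apply] using h3

end TwoCopies

/-! ### Explicit group elements from generators -/

section Elements

variable {n : ℕ} {𝒢 : Set (PauliString n)}

/-- An involution M splits the identity into (1 ± M)/2, so ℂ × ℂ maps to matrices by a ring
homomorphism sending (1, −1) to M. The exponential is then computed in each coordinate. -/
theorem exp_smul_I_smul_of_mul_self {m : Type*} [Fintype m] [DecidableEq m] {M : Matrix m m ℂ}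
    (hM : M * M = 1) (t : ℝ) :
    NormedSpace.exp (t • Complex.I • M) =
      (Real.cos t : ℂ) • (1 : Matrix m m ℂ) + (Real.sin t : ℂ) • Complex.I • M := by
  open scoped Matrix.Norms.Operator in
  let f : ℂ × ℂ →+* Matrix m m ℂ :=
    { toFun := fun z => ((z.1 + z.2) / 2) • (1 : Matrix m m ℂ) + ((z.1 - z.2) / 2) • M
      map_one' := by simp
      map_mul' := fun z w => by
        simp only [Prod.fst_mul, Prod.snd_mul, mul_add, add_mul, smul_mul_smul_comm, mul_one,
          one_mul, hM]
        module
      map_zero' := by simp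
      map_add' := fun z w => by
        simp only [Prod.fst_add, Prod.snd_add]
        module }
  have hf : Continuous f := by
    change Continuous fun z : ℂ × ℂ =>
      ((z.1 + z.2) / 2) • (1 : Matrix m m ℂ) + ((z.1 - z.2) / 2) • M
    fun_prop
  have h := NormedSpace.map_exp f hf (t * Complex.I, -t * Complex.I)
  have hl : f (t * Complex.I, -t * Complex.I) = t • Complex.I • M := by
    change ((t * Complex.I + -t * Complex.I) / 2) • (1 : Matrix m m ℂ) +
      ((t * Complex.I - -t * Complex.I) / 2) • M = _
    rw [← Complex.coe_smul]
    module
  rw [hl] at h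
  refine h.symm.trans ?_
  change (((NormedSpace.exp ((t * Complex.I, -t * Complex.I) : ℂ × ℂ)).1 +
    (NormedSpace.exp ((t * Complex.I, -t * Complex.I) : ℂ × ℂ)).2) / 2) • (1 : Matrix m m ℂ) +
      (((NormedSpace.exp ((t * Complex.I, -t * Complex.I) : ℂ × ℂ)).1 -
    (NormedSpace.exp ((t * Complex.I, -t * Complex.I) : ℂ × ℂ)).2) / 2) • M = _
  rw [Prod.fst_exp, Prod.snd_exp, ← Complex.exp_eq_exp_ℂ, smul_smul, Complex.ofReal_cos,
    Complex.ofReal_sin, Complex.exp_mul_I, Complex.exp_mul_I, Complex.cos_neg, Complex.sin_neg]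
  congr 2 <;> ring

/-- The one-parameter subgroup generated by a generator. -/
theorem exists_mem_dynamicalGroup {X : PauliString n} (hX : X ∈ 𝒢) (t : ℝ) :
    ∃ V : dynamicalGroup 𝒢, (V : QubitOp n) =
      (Real.cos t : ℂ) • (1 : QubitOp n) + (Real.sin t : ℂ) • Complex.I • X.op := by
  have hu : (Real.cos t : ℂ) • (1 : QubitOp n) + (Real.sin t : ℂ) • Complex.I • X.op ∈
      Matrix.unitaryGroup (QubitBasis n) ℂ := by
    rw [Matrix.mem_unitaryGroup_iff, Matrix.star_eq_conjTranspose, Matrix.conjTranspose_add,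
      Matrix.conjTranspose_smul, Matrix.conjTranspose_smul, Matrix.conjTranspose_smul,
      Matrix.conjTranspose_one, X.conjTranspose_op, Complex.star_def, Complex.conj_ofReal,
      Complex.conj_ofReal, Complex.conj_I]
    simp only [mul_add, add_mul, smul_mul_smul_comm, mul_one, one_mul, X.op_mul_self, smul_smul]
    have h : (Real.cos t : ℂ) * Real.cos t + Real.sin t * Real.sin t = 1 := by
      norm_cast
      rw [← sq, ← sq, Real.cos_sq_add_sin_sq]
    have h2 : (Real.sin t * Complex.I) * (Real.sin t * -Complex.I) =
        (Real.sin t : ℂ) * Real.sin t := by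
      linear_combination -((Real.sin t : ℂ) * Real.sin t) * Complex.I_mul_I
    rw [h2]
    calc _ = ((Real.cos t : ℂ) * Real.cos t + Real.sin t * Real.sin t) • (1 : QubitOp n) := by
            module
      _ = 1 := by rw [h, one_smul]
  refine ⟨⟨⟨_, hu⟩, subset_closure (Subgroup.subset_closure ⟨t • Complex.I • X.op, ?_, ?_⟩)⟩, rfl⟩
  · exact LieSubalgebra.smul_mem _ _ (LieSubalgebra.subset_lieSpan ⟨X, hX, rfl⟩)
  · exact (exp_smul_I_smul_of_mul_self X.op_mul_self t).symm

/-- The time π/2 of the one-parameter group. The phase i drops out of conjugation, so this element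
acts as conjugation by X. -/
theorem exists_mem_dynamicalGroup_I_smul {X : PauliString n} (hX : X ∈ 𝒢) :
    ∃ V : dynamicalGroup 𝒢, (V : QubitOp n) = Complex.I • X.op := by
  obtain ⟨V, hV⟩ := exists_mem_dynamicalGroup hX (Real.pi / 2)
  refine ⟨V, ?_⟩
  simpa using hV

/-- Linear symmetries commute with the generators. -/
theorem IsLinearSymmetry.commute {L : QubitOp n} (hL : IsLinearSymmetry 𝒢 L) {X : PauliString n}
    (hX : X ∈ 𝒢) : Commute L X.op := by
  obtain ⟨V, hV⟩ := exists_mem_dynamicalGroup_I_smul hX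
  have h := hL V V.2
  rw [hV, mul_smul_comm, smul_mul_assoc] at h
  exact smul_right_injective _ Complex.I_ne_zero h

theorem isLinearSymmetry_iff {L : QubitOp n} :
    IsLinearSymmetry 𝒢 L ↔ ∀ X ∈ 𝒢, Commute L X.op :=
  ⟨fun h _ hX => h.commute hX, isLinearSymmetry_of_commute⟩

end Elements

/-! ### Right invariance of Haar measure on a compact group -/

section Haar

/-- A right translate of μ is again a Haar probability measure, and such a measure is unique. -/
theorem isMulRightInvariant_of_isHaarMeasure_of_isProbabilityMeasure {G : Type*} [Group G]
    [TopologicalSpace G] [IsTopologicalGroup G] [CompactSpace G] [MeasurableSpace G] [BorelSpace G]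
    (μ : Measure G) [μ.IsHaarMeasure] [IsProbabilityMeasure μ] : μ.IsMulRightInvariant := by
  refine ⟨fun g => ?_⟩
  have : IsProbabilityMeasure (Measure.map (· * g) μ) :=
    Measure.isProbabilityMeasure_map (measurable_mul_const g).aemeasurable
  exact Measure.isHaarMeasure_eq_of_isProbabilityMeasure _ _

end Haar

/-! ### Invariants of a component of the graph -/

section Component

open scoped Kronecker

variable {n : ℕ} {𝒢 : Set (PauliString n)}

/-- A property of operators that is stable under the edges of the commutator graph holds on the
component of `Q` as soon as it holds at `Q`. -/
theorem graphComponent_induction {p : QubitOp n → Prop} {Q T : PauliString n}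
    (hT : T ∈ graphComponent 𝒢 Q) (hQ : p Q.op)
    (step : ∀ X ∈ 𝒢, ∀ (T : PauliString n) (e : ℂ), X.op * T.op = -(T.op * X.op) → e * e = 1 →
      p T.op → p (e • Complex.I • (X.op * T.op))) : p T.op := by
  have h := (SimpleGraph.reachable_iff_reflTransGen Q T).mp hT
  induction h with
  | refl => exact hQ
  | tail hab hbc ih =>
    obtain ⟨X, hX, ha, e, he, hm⟩ := exists_of_commutatorGraph_adj hbc
    rw [hm]
    exact step X hX _ e ha he (ih ((SimpleGraph.reachable_iff_reflTransGen _ _).mpr hab))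

theorem mem_graphComponent_self (Q : PauliString n) : Q ∈ graphComponent 𝒢 Q :=
  SimpleGraph.Reachable.refl Q

theorem mul_mem_graphComponent_iff {X Q T : PauliString n} (hX : X ∈ 𝒢)
    (h : X.op * T.op = -(T.op * X.op)) :
    X.mul T ∈ graphComponent 𝒢 Q ↔ T ∈ graphComponent 𝒢 Q :=
  ⟨fun hT => SimpleGraph.Reachable.trans hT (commutatorGraph_adj_mul hX h).symm.reachable,
    fun hT => SimpleGraph.Reachable.trans hT (commutatorGraph_adj_mul hX h).reachable⟩

/-- Along an edge T becomes ±iXT. The factor i² = −1 cancels the sign from exchanging X and T, and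
the two copies of X meet across L and square to 1. -/
theorem mul_symmetry_mul_eq_of_mem_graphComponent {L : QubitOp n} (hL : ∀ X ∈ 𝒢, Commute L X.op)
    {Q T : PauliString n} (hT : T ∈ graphComponent 𝒢 Q) :
    T.op * L * T.op = Q.op * L * Q.op := by
  refine graphComponent_induction (p := fun T => T * L * T = Q.op * L * Q.op) hT rfl ?_
  intro X hX T e ha he ih
  rw [← ih]
  calc (e • Complex.I • (X.op * T.op)) * L * (e • Complex.I • (X.op * T.op))
      = (e * e) • (Complex.I * Complex.I) • ((X.op * T.op) * L * (X.op * T.op)) := by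
        simp only [smul_mul_assoc, mul_smul_comm, smul_smul]
        congr 1
        ring
    _ = -((X.op * T.op) * L * (X.op * T.op)) := by
        rw [he, one_smul, Complex.I_mul_I, neg_one_smul]
    _ = (T.op * X.op) * L * (X.op * T.op) := by rw [ha, neg_mul, neg_mul, neg_neg]
    _ = T.op * (X.op * L) * X.op * T.op := by noncomm_ring
    _ = T.op * L * (X.op * X.op) * T.op := by rw [← (hL X hX).eq]; noncomm_ring
    _ = T.op * L * T.op := by rw [X.op_mul_self, mul_one]

open Classical in
/-- The sum of `T ⊗ T` over a component of the commutator graph commutes with the generators. -/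
theorem commute_sum_kronecker_kroneckerSum (Q : PauliString n) {X : PauliString n} (hX : X ∈ 𝒢) :
    Commute (∑ T : PauliString n with T ∈ graphComponent 𝒢 Q, T.op ⊗ₖ T.op)
      (kroneckerSum X.op) := by
  let D : Matrix (QubitBasis n × QubitBasis n) (QubitBasis n × QubitBasis n) ℂ →
    Matrix (QubitBasis n × QubitBasis n) (QubitBasis n × QubitBasis n) ℂ :=
    fun M => M * kroneckerSum X.op - kroneckerSum X.op * M
  have hD (T : PauliString n) : D (T.op ⊗ₖ T.op) =
      (T.op * X.op - X.op * T.op) ⊗ₖ T.op + T.op ⊗ₖ (T.op * X.op - X.op * T.op) := by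
    simp only [D, kroneckerSum, mul_add, add_mul, ← Matrix.mul_kronecker_mul, one_mul, mul_one,
      sub_eq_add_neg, Matrix.add_kronecker, Matrix.kronecker_add,
      ← neg_one_smul ℂ (X.op * T.op), Matrix.smul_kronecker, Matrix.kronecker_smul]
    module
  -- With T' the partner of T, [T, X] = 2ieT' and [T', X] = −2ieT, so both terms are multiples of T
  -- ⊗ T' + T' ⊗ T with opposite coefficients.
  have hneg (T : PauliString n) (ha : X.op * T.op = -(T.op * X.op)) :
      D (T.op ⊗ₖ T.op) + D ((X.mul T).op ⊗ₖ (X.mul T).op) = 0 := by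
    obtain ⟨e, he, hm⟩ := PauliString.exists_I_smul_mul ha
    have hT : T.op * X.op - X.op * T.op = (2 * Complex.I * e) • (X.mul T).op := by
      rw [mul_smul, ← hm, smul_smul, mul_assoc, Complex.I_mul_I, ha]
      module
    have hq : (X.mul T).op = (e * Complex.I) • (X.op * T.op) := by
      rw [mul_smul, hm, smul_smul, he, one_smul]
    have hT' : (X.mul T).op * X.op - X.op * (X.mul T).op = -(2 * Complex.I * e) • T.op := by
      have h1 : X.op * T.op * X.op = -T.op := by
        rw [ha, neg_mul, mul_assoc, X.op_mul_self, mul_one]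
      have h2 : X.op * (X.op * T.op) = T.op := by rw [← mul_assoc, X.op_mul_self, one_mul]
      rw [hq, smul_mul_assoc, mul_smul_comm, h1, h2]
      module
    rw [hD, hD, hT, hT', Matrix.smul_kronecker, Matrix.smul_kronecker, Matrix.kronecker_smul,
      Matrix.kronecker_smul]
    module
  have hzero (T : PauliString n) (hc : X.op * T.op = T.op * X.op) : D (T.op ⊗ₖ T.op) = 0 := by
    rw [hD, hc, sub_self, Matrix.zero_kronecker, Matrix.kronecker_zero, add_zero]
  have hanti (T : PauliString n) (ha : X.op * T.op = -(T.op * X.op)) :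
      X.op * (X.mul T).op = -((X.mul T).op * X.op) := by
    obtain ⟨c, hc, hm⟩ := X.exists_op_mul T
    have : (X.mul T).op = c⁻¹ • (X.op * T.op) := by
      rw [hm, smul_smul, inv_mul_cancel₀ hc, one_smul]
    rw [this, mul_smul_comm, smul_mul_assoc, ← smul_neg, ha, mul_neg, neg_mul, neg_neg,
      ← mul_assoc, ha, neg_mul, neg_neg]
  have hsum : ∑ T : PauliString n with T ∈ graphComponent 𝒢 Q, D (T.op ⊗ₖ T.op) = 0 := by
    -- Strings that anticommute with X are paired by T ↔ XT inside the component; the others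
    -- contribute zero.
    refine Finset.sum_involution
      (fun T _ => if X.op * T.op = -(T.op * X.op) then X.mul T else T) ?_ ?_ ?_ ?_
    · intro T hT
      split_ifs with ha
      · exact hneg T ha
      · simp [hzero T ((X.op_comm_or T).resolve_right ha)]
    · intro T hT hne heq
      split_ifs at heq with ha
      · have := (commutatorGraph_adj_mul hX ha).ne
        exact this heq.symm
      · exact hne (hzero T ((X.op_comm_or T).resolve_right ha))
    · intro T hT
      simp only [Finset.mem_filter, Finset.mem_univ, true_and] at hT ⊢
      split_ifs with ha
      · exact (mul_mem_graphComponent_iff hX ha).mpr hT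
      · exact hT
    · intro T hT
      by_cases ha : X.op * T.op = -(T.op * X.op)
      · rw [if_pos ha, if_pos (hanti T ha), PauliString.mul_mul_cancel]
      · rw [if_neg ha, if_neg ha]
  rw [commute_iff_eq, ← sub_eq_zero, Finset.sum_mul, Finset.mul_sum, ← Finset.sum_sub_distrib]
  exact hsum

open Classical in
/-- The map `M ↦ ∑ T M T` over a component does not change when every `T` is conjugated by an
element of the dynamical group. -/
theorem sum_conj_mul_mul_conj (Q : PauliString n) (U : dynamicalGroup 𝒢) (M : QubitOp n) :
    ∑ T : PauliString n with T ∈ graphComponent 𝒢 Q,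
      ((U : QubitOp n) * T.op * (U : QubitOp n).conjTranspose) * M *
        ((U : QubitOp n) * T.op * (U : QubitOp n).conjTranspose) =
    ∑ T : PauliString n with T ∈ graphComponent 𝒢 Q, T.op * M * T.op := by
  have hU : (U : QubitOp n) * (U : QubitOp n).conjTranspose = 1 :=
    Matrix.mem_unitaryGroup_iff.mp U.1.2
  have h := (commute_kronecker_of_mem (fun X hX => commute_sum_kronecker_kroneckerSum Q hX)
    U.2).eq
  have h2 := congrArg
    (· * ((U : QubitOp n).conjTranspose ⊗ₖ (U : QubitOp n).conjTranspose)) h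
  simp only [mul_assoc, ← Matrix.mul_kronecker_mul, hU, mul_one,
    Finset.sum_mul, Finset.mul_sum] at h2
  -- The entries of ∑ A M A depend linearly on those of ∑ A ⊗ A, so the two-copy identity transfers.
  have hent (A : PauliString n → QubitOp n) (i j : QubitBasis n) :
      (∑ T : PauliString n with T ∈ graphComponent 𝒢 Q, A T * M * A T) i j =
      ∑ k, ∑ l, (∑ T : PauliString n with T ∈ graphComponent 𝒢 Q, A T ⊗ₖ A T) (i, l) (k, j) *
        M k l := by
    have hT (T : PauliString n) : (A T * M * A T) i j =
        ∑ k, ∑ l, (A T ⊗ₖ A T) (i, l) (k, j) * M k l := by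
      simp only [Matrix.mul_apply, Matrix.kronecker_apply, Finset.sum_mul]
      rw [Finset.sum_comm]
      exact Finset.sum_congr rfl fun k _ => Finset.sum_congr rfl fun l _ => by ring
    simp only [Matrix.sum_apply, hT, Finset.sum_mul]
    rw [Finset.sum_comm]
    exact Finset.sum_congr rfl fun k _ => Finset.sum_comm
  ext i j
  rw [hent, hent]
  simp only [mul_assoc]
  rw [← h2]

end Component

/-! ### Averaging the correlator -/

section Twirl

variable {n : ℕ} {𝒢 : Set (PauliString n)}

/-- The correlator `tr[P U A U† R U B U†]`. -/
def correlator (P R A B U : QubitOp n) : ℂ :=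
  (P * U * A * U.conjTranspose * R * U * B * U.conjTranspose).trace

theorem continuous_correlator (P R A B : QubitOp n) : Continuous (correlator P R A B) := by
  have hs : Continuous fun U : QubitOp n => U.conjTranspose := continuous_id.matrix_conjTranspose
  have hc (A : QubitOp n) : Continuous fun _ : QubitOp n => A := continuous_const
  exact ((((((((hc P).matrix_mul continuous_id).matrix_mul (hc A)).matrix_mul hs).matrix_mul
    (hc R)).matrix_mul continuous_id).matrix_mul (hc B)).matrix_mul hs).matrix_trace

theorem correlator_conj (P R A B U V : QubitOp n) :
    correlator P R (V * A * V.conjTranspose) (V * B * V.conjTranspose) U =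
      correlator P R A B (U * V) := by
  simp only [correlator, Matrix.conjTranspose_mul, mul_assoc]

theorem integrable_correlator [MeasurableSpace (dynamicalGroup 𝒢)]
    [BorelSpace (dynamicalGroup 𝒢)] (μ : Measure (dynamicalGroup 𝒢)) [IsFiniteMeasure μ]
    (P R A B : QubitOp n) :
    Integrable (fun U : dynamicalGroup 𝒢 => correlator P R A B U) μ :=
  ((continuous_correlator P R A B).comp
    (continuous_subtype_val.comp continuous_subtype_val)).integrable_of_hasCompactSupport
    (HasCompactSupport.of_compactSpace _)

-- Cyclicity brings T P R T L to P R (T L T), where T L T = Q L Q. Replacing P T by T P costs −1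
-- exactly for anticommuting T, hence the count |C_Q| − 2·#.
open Classical in
theorem sum_trace_mul_mul_symmetry (P Q : PauliString n) (R : QubitOp n) {L : QubitOp n}
    (hL : ∀ X ∈ 𝒢, Commute L X.op) :
    ∑ T : PauliString n with T ∈ graphComponent 𝒢 Q, (P.op * T.op * R * T.op * L).trace =
    (((graphComponent 𝒢 Q).ncard : ℂ) -
      2 * ({T ∈ graphComponent 𝒢 Q | P.op * T.op + T.op * P.op = 0}.ncard : ℂ)) *
        (P.op * R * (Q.op * L * Q.op)).trace := by
  have hcard (s : Set (PauliString n)) : s.ncard = (Finset.univ.filter (· ∈ s)).card := by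
    rw [← Set.ncard_coe_finset]
    simp
  have hterm (T : PauliString n) (hT : T ∈ graphComponent 𝒢 Q) :
      (P.op * T.op * R * T.op * L).trace =
        (1 - 2 * (if P.op * T.op + T.op * P.op = 0 then 1 else 0)) *
          (P.op * R * (Q.op * L * Q.op)).trace := by
    have h1 : (T.op * P.op * R * T.op * L).trace = (P.op * R * (Q.op * L * Q.op)).trace := by
      rw [← mul_symmetry_mul_eq_of_mem_graphComponent hL hT, mul_assoc, mul_assoc, mul_assoc,
        Matrix.trace_mul_comm]
      simp only [mul_assoc]
    split_ifs with ha
    · rw [eq_neg_of_add_eq_zero_left ha]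
      simp only [neg_mul, Matrix.trace_neg, h1]
      ring
    · rcases P.op_comm_or T with h | h
      · rw [h, h1]
        ring
      · exact absurd (by rw [h, neg_add_cancel]) ha
  rw [Finset.sum_congr rfl fun T hT => hterm T (Finset.mem_filter.mp hT).2, ← Finset.sum_mul,
    Finset.sum_sub_distrib, ← Finset.mul_sum, Finset.sum_const, nsmul_eq_mul, mul_one,
    Finset.sum_boole, Finset.filter_filter, hcard, hcard]
  simp only [Set.mem_ofPred_eq]

variable [MeasurableSpace (dynamicalGroup 𝒢)] [BorelSpace (dynamicalGroup 𝒢)]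
  (μ : Measure (dynamicalGroup 𝒢)) [μ.IsHaarMeasure] [IsProbabilityMeasure μ]

theorem integral_correlator_conj (P R A B : QubitOp n) (V : dynamicalGroup 𝒢) :
    ∫ U : dynamicalGroup 𝒢, correlator P R ((V : QubitOp n) * A * (V : QubitOp n).conjTranspose)
      ((V : QubitOp n) * B * (V : QubitOp n).conjTranspose) U ∂μ =
    ∫ U : dynamicalGroup 𝒢, correlator P R A B U ∂μ := by
  have := isMulRightInvariant_of_isHaarMeasure_of_isProbabilityMeasure μ
  rw [← integral_mul_right_eq_self (fun U : dynamicalGroup 𝒢 => correlator P R A B U) V]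
  simp only [correlator_conj]
  rfl

theorem integral_correlator_conj_generator (P R A B : QubitOp n) {X : PauliString n}
    (hX : X ∈ 𝒢) :
    ∫ U : dynamicalGroup 𝒢, correlator P R (X.op * A * X.op) (X.op * B * X.op) U ∂μ =
    ∫ U : dynamicalGroup 𝒢, correlator P R A B U ∂μ := by
  obtain ⟨V, hV⟩ := exists_mem_dynamicalGroup_I_smul hX
  rw [← integral_correlator_conj μ P R A B V, hV]
  simp [Matrix.conjTranspose_smul, X.conjTranspose_op, smul_smul]

/-- Conjugation by X fixes A and negates B, so the integral is its own negative. -/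
theorem integral_correlator_eq_zero_of_comm_of_anticomm (P R A B : QubitOp n) {X : PauliString n}
    (hX : X ∈ 𝒢) (hA : X.op * A = A * X.op) (hB : X.op * B = -(B * X.op)) :
    ∫ U : dynamicalGroup 𝒢, correlator P R A B U ∂μ = 0 := by
  have h := integral_correlator_conj_generator μ P R A B hX
  rw [hA, hB, neg_mul, mul_assoc, mul_assoc, X.op_mul_self, mul_one, mul_one] at h
  simp only [correlator, mul_neg, neg_mul, Matrix.trace_neg, integral_neg] at h ⊢
  exact self_eq_neg.mp h.symm

theorem integral_correlator_eq_zero_of_anticomm_of_comm (P R A B : QubitOp n) {X : PauliString n}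
    (hX : X ∈ 𝒢) (hA : X.op * A = -(A * X.op)) (hB : X.op * B = B * X.op) :
    ∫ U : dynamicalGroup 𝒢, correlator P R A B U ∂μ = 0 := by
  have h := integral_correlator_conj_generator μ P R A B hX
  rw [hA, hB, neg_mul, mul_assoc, mul_assoc, X.op_mul_self, mul_one, mul_one] at h
  simp only [correlator, mul_neg, neg_mul, Matrix.trace_neg, integral_neg] at h ⊢
  exact self_eq_neg.mp h.symm

theorem integral_correlator_of_anticomm (P R A B : QubitOp n) {X : PauliString n}
    (hX : X ∈ 𝒢) (hA : X.op * A = -(A * X.op)) (hB : X.op * B = -(B * X.op)) :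
    ∫ U : dynamicalGroup 𝒢, correlator P R (Complex.I • (X.op * A)) (Complex.I • (X.op * B)) U ∂μ =
    ∫ U : dynamicalGroup 𝒢, correlator P R A B U ∂μ := by
  -- V = (1 + iX)/√2. For C anticommuting with X, V C V† = V² C = iXC.
  obtain ⟨V, hV⟩ := exists_mem_dynamicalGroup hX (Real.pi / 4)
  have hs : ((√2 / 2 : ℝ) : ℂ) * ((√2 / 2 : ℝ) : ℂ) = 1 / 2 := by
    rw [← Complex.ofReal_mul, div_mul_div_comm, Real.mul_self_sqrt zero_le_two]
    norm_num
  rw [Real.cos_pi_div_four, Real.sin_pi_div_four, ← smul_add] at hV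
  have key (C : QubitOp n) (hC : X.op * C = -(C * X.op)) :
      (V : QubitOp n) * C * (V : QubitOp n).conjTranspose = Complex.I • (X.op * C) := by
    have hC' : C * X.op = -(X.op * C) := by rw [hC, neg_neg]
    have h1 : X.op * C * X.op = -C := by
      rw [mul_assoc, hC', mul_neg, ← mul_assoc, X.op_mul_self, one_mul]
    rw [hV, Matrix.conjTranspose_smul, Matrix.conjTranspose_add, Matrix.conjTranspose_smul,
      Matrix.conjTranspose_one, X.conjTranspose_op, Complex.star_def, Complex.conj_ofReal,
      Complex.conj_I, smul_mul_assoc, smul_mul_smul_comm, hs]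
    simp only [add_mul, mul_add, one_mul, mul_one, smul_mul_assoc, mul_smul_comm, hC', h1]
    match_scalars
    · linear_combination (1 / 2 : ℂ) * Complex.I_mul_I
    · ring
  rw [← integral_correlator_conj μ P R A B V, key A hA, key B hB]

theorem integral_correlator_of_mem_graphComponent (P R : QubitOp n) {L : QubitOp n}
    (hL : ∀ X ∈ 𝒢, Commute L X.op) {Q T : PauliString n} (hT : T ∈ graphComponent 𝒢 Q) :
    ∫ U : dynamicalGroup 𝒢, correlator P R T.op (T.op * L) U ∂μ =
    ∫ U : dynamicalGroup 𝒢, correlator P R Q.op (Q.op * L) U ∂μ := by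
  refine graphComponent_induction (p := fun T =>
    ∫ U : dynamicalGroup 𝒢, correlator P R T (T * L) U ∂μ =
      ∫ U : dynamicalGroup 𝒢, correlator P R Q.op (Q.op * L) U ∂μ) hT rfl ?_
  intro X hX T e ha he ih
  have hTL : X.op * (T.op * L) = -(T.op * L * X.op) := by
    rw [← mul_assoc, ha, mul_assoc T.op, (hL X hX).eq, neg_mul, mul_assoc]
  rw [← ih, ← integral_correlator_of_anticomm μ P R T.op (T.op * L) hX ha hTL]
  -- The sign e enters through both slots, so only e² = 1 matters.
  refine integral_congr_ae (Filter.Eventually.of_forall fun U => ?_)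
  simp only [correlator, smul_mul_assoc, mul_smul_comm, Matrix.trace_smul, smul_eq_mul, mul_assoc]
  linear_combination (Complex.I * (Complex.I * (P * ((U : QubitOp n) * (X.op * (T.op *
    ((U : QubitOp n).conjTranspose * (R * ((U : QubitOp n) * (X.op * (T.op * (L *
      (U : QubitOp n).conjTranspose)))))))))).trace)) * he

/-- The correlator vanishes on average unless `A B` commutes with all generators. -/
theorem integral_correlator_eq_zero (P R : QubitOp n) {Q S : PauliString n}
    (h : ¬ ∀ X ∈ 𝒢, Commute (Q.op * S.op) X.op) :
    ∫ U : dynamicalGroup 𝒢, correlator P R Q.op S.op U ∂μ = 0 := by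
  push Not at h
  obtain ⟨X, hX, h⟩ := h
  -- Equal signs of X against Q and S would make X commute with QS; only the mixed cases remain.
  rcases X.op_comm_or Q with hQ | hQ <;> rcases X.op_comm_or S with hS | hS
  · refine absurd ?_ h
    rw [commute_iff_eq, mul_assoc, ← hS, ← mul_assoc, ← hQ, mul_assoc]
  · exact integral_correlator_eq_zero_of_comm_of_anticomm μ P R _ _ hX hQ hS
  · exact integral_correlator_eq_zero_of_anticomm_of_comm μ P R _ _ hX hQ hS
  · refine absurd ?_ h
    rw [commute_iff_eq, ← mul_assoc, hQ, neg_mul, mul_assoc, mul_assoc, hS, mul_neg, neg_neg]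

-- The integral is constant on the component, so the left side is a sum of integrals over it. The
-- summed integrand is independent of U: L passes through U†, and U T U† may be replaced by T in the
-- sum.
open Classical in
theorem card_mul_integral_correlator (P R : QubitOp n) {L : QubitOp n}
    (hL : ∀ X ∈ 𝒢, Commute L X.op) (Q : PauliString n) :
    ((graphComponent 𝒢 Q).ncard : ℂ) *
      ∫ U : dynamicalGroup 𝒢, correlator P R Q.op (Q.op * L) U ∂μ =
    ∑ T : PauliString n with T ∈ graphComponent 𝒢 Q, (P * T.op * R * T.op * L).trace := by
  have hcard : (graphComponent 𝒢 Q).ncard =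
      (Finset.univ.filter (· ∈ graphComponent 𝒢 Q)).card := by
    rw [← Set.ncard_coe_finset]
    simp
  have h1 : ((graphComponent 𝒢 Q).ncard : ℂ) *
      ∫ U : dynamicalGroup 𝒢, correlator P R Q.op (Q.op * L) U ∂μ =
      ∑ T : PauliString n with T ∈ graphComponent 𝒢 Q,
        ∫ U : dynamicalGroup 𝒢, correlator P R T.op (T.op * L) U ∂μ := by
    rw [hcard, ← nsmul_eq_mul, ← Finset.sum_const]
    refine Finset.sum_congr rfl fun T hT => ?_
    exact (integral_correlator_of_mem_graphComponent μ P R hL (Finset.mem_filter.mp hT).2).symm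
  rw [h1, ← integral_finsetSum _ fun T _ => integrable_correlator μ P R T.op (T.op * L)]
  have h2 (U : dynamicalGroup 𝒢) :
      ∑ T : PauliString n with T ∈ graphComponent 𝒢 Q, correlator P R T.op (T.op * L) U =
      ∑ T : PauliString n with T ∈ graphComponent 𝒢 Q, (P * T.op * R * T.op * L).trace := by
    have hLU : L * (U : QubitOp n).conjTranspose = (U : QubitOp n).conjTranspose * L :=
      isLinearSymmetry_of_commute hL _ (U⁻¹).2
    have h3 := congrArg (fun M => (P * M * L).trace) (sum_conj_mul_mul_conj Q U R)
    simp only [Finset.mul_sum, Finset.sum_mul, Matrix.trace_sum] at h3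
    simp only [correlator, mul_assoc, hLU] at h3 ⊢
    exact h3
  simp only [h2, integral_const, probReal_univ, one_smul]

end Twirl

/-! ### The superoperator T⁽¹⁾ on products of strings -/

section LinearTwirl

variable {n : ℕ} {𝒢 : Set (PauliString n)}

theorem linearTwirl_op_of_isLinearSymmetry {r : PauliString n} (hr : IsLinearSymmetry 𝒢 r.op) :
    linearTwirl 𝒢 r.op = (2 ^ n : ℂ) • r.op := by
  classical
  simp only [linearTwirl, LinearMap.coe_mk, AddHom.coe_mk, PauliString.hsInner_op,
    PauliString.trace_op_mul, ite_smul, zero_smul]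
  rw [Finset.sum_ite_eq', if_pos (by simpa using hr)]

theorem linearTwirl_op_of_not_isLinearSymmetry {r : PauliString n}
    (hr : ¬ IsLinearSymmetry 𝒢 r.op) : linearTwirl 𝒢 r.op = 0 := by
  classical
  simp only [linearTwirl, LinearMap.coe_mk, AddHom.coe_mk, PauliString.hsInner_op,
    PauliString.trace_op_mul, ite_smul, zero_smul]
  rw [Finset.sum_ite_eq', if_neg (by simpa using hr)]

theorem isLinearSymmetry_smul_iff {c : ℂ} (hc : c ≠ 0) {L : QubitOp n} :
    IsLinearSymmetry 𝒢 (c • L) ↔ IsLinearSymmetry 𝒢 L := by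
  simp only [IsLinearSymmetry, smul_mul_assoc, mul_smul_comm]
  exact forall₂_congr fun U _ => (smul_right_injective _ hc).eq_iff

/-- Products of Pauli strings in either order are proportional. -/
theorem exists_op_mul_eq_smul_op_mul (Q S : PauliString n) :
    ∃ c : ℂ, c ≠ 0 ∧ Q.op * S.op = c • (S.op * Q.op) := by
  rcases Q.op_comm_or S with h | h
  · exact ⟨1, one_ne_zero, by rw [one_smul, h]⟩
  · exact ⟨-1, by norm_num, by rw [neg_one_smul, h]⟩

theorem linearTwirl_op_mul_of_isLinearSymmetry {Q S : PauliString n}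
    (h : IsLinearSymmetry 𝒢 (S.op * Q.op)) :
    linearTwirl 𝒢 (S.op * Q.op) = (2 ^ n : ℂ) • (S.op * Q.op) := by
  obtain ⟨c, hc, hm⟩ := S.exists_op_mul Q
  rw [hm, isLinearSymmetry_smul_iff hc] at h
  rw [hm, map_smul, linearTwirl_op_of_isLinearSymmetry h, smul_comm]

theorem linearTwirl_op_mul_of_not_isLinearSymmetry {Q S : PauliString n}
    (h : ¬ IsLinearSymmetry 𝒢 (S.op * Q.op)) : linearTwirl 𝒢 (S.op * Q.op) = 0 := by
  obtain ⟨c, hc, hm⟩ := S.exists_op_mul Q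
  rw [hm, isLinearSymmetry_smul_iff hc] at h
  rw [hm, map_smul, linearTwirl_op_of_not_isLinearSymmetry h, smul_zero]

/-- The symmetry is the string underlying SQ. By orthogonality a nonzero pairing forces RP to have
the same underlying string, and QS = ±SQ. -/
theorem exists_isLinearSymmetry_of_hsInner_linearTwirl_ne_zero {P Q R S : PauliString n}
    (h : hsInner (R.op * P.op) (linearTwirl 𝒢 (S.op * Q.op)) ≠ 0) :
    ∃ L : QubitOp n, IsLinearSymmetry 𝒢 L ∧
      (∃ a : ℂ, R.op * P.op = a • L) ∧ (∃ b : ℂ, Q.op * S.op = b • L) := by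
  by_cases hs : IsLinearSymmetry 𝒢 (S.op * Q.op)
  · rw [linearTwirl_op_mul_of_isLinearSymmetry hs] at h
    obtain ⟨a, ha, hRP⟩ := R.exists_op_mul P
    obtain ⟨c, hc, hSQ⟩ := S.exists_op_mul Q
    obtain ⟨b, hb, hQS⟩ := exists_op_mul_eq_smul_op_mul Q S
    have hrp : R.mul P = S.mul Q := by
      by_contra hne
      refine h ?_
      rw [hRP, hSQ, hsInner, Matrix.conjTranspose_smul, PauliString.conjTranspose_op]
      simp [PauliString.trace_op_mul, hne]
    refine ⟨(S.mul Q).op, ?_, ⟨a, by rw [hRP, hrp]⟩, b * c, by rw [hQS, hSQ, smul_smul]⟩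
    rwa [hSQ, isLinearSymmetry_smul_iff hc] at hs
  · rw [linearTwirl_op_mul_of_not_isLinearSymmetry hs] at h
    simp [hsInner] at h

end LinearTwirl

/-! ### The averaged correlator formula -/

theorem integral_correlator_eq {n : ℕ} (𝒢 : Set (PauliString n))
    [MeasurableSpace (dynamicalGroup 𝒢)] [BorelSpace (dynamicalGroup 𝒢)]
    (μ : Measure (dynamicalGroup 𝒢)) [μ.IsHaarMeasure] [IsProbabilityMeasure μ]
    (P Q R S : PauliString n) :
    ∫ U : dynamicalGroup 𝒢, correlator P.op R.op Q.op S.op U ∂μ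
      = ((2 : ℂ) ^ n)⁻¹ * hsInner (R.op * P.op) (linearTwirl 𝒢 (S.op * Q.op)) *
          (1 - 2 * ({T ∈ graphComponent 𝒢 Q | P.op * T.op + T.op * P.op = 0}.ncard : ℂ) /
            ((graphComponent 𝒢 Q).ncard : ℂ)) := by
  obtain ⟨c, hc, hm⟩ := exists_op_mul_eq_smul_op_mul Q S
  by_cases h : IsLinearSymmetry 𝒢 (Q.op * S.op)
  · have h' := h
    rw [hm, isLinearSymmetry_smul_iff hc] at h'
    have hL := isLinearSymmetry_iff.mp h
    -- With L = QS this gives QL = S and QLQ = SQ.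
    have hQS : Q.op * (Q.op * S.op) = S.op := by rw [← mul_assoc, Q.op_mul_self, one_mul]
    have hmain := card_mul_integral_correlator μ P.op R.op hL Q
    rw [sum_trace_mul_mul_symmetry P Q R.op hL, hQS] at hmain
    have hcard : ((graphComponent 𝒢 Q).ncard : ℂ) ≠ 0 := by
      rw [Nat.cast_ne_zero, Ne, Set.ncard_eq_zero, ← Ne, ← Set.nonempty_iff_ne_empty]
      exact ⟨Q, mem_graphComponent_self Q⟩
    rw [linearTwirl_op_mul_of_isLinearSymmetry h', hsInner, Matrix.conjTranspose_mul,
      P.conjTranspose_op, R.conjTranspose_op, mul_smul_comm, Matrix.trace_smul, smul_eq_mul,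
      inv_mul_cancel_left₀ (pow_ne_zero _ two_ne_zero)]
    refine mul_left_cancel₀ hcard (hmain.trans ?_)
    field_simp
  · have h' : ¬ IsLinearSymmetry 𝒢 (S.op * Q.op) := by
      rwa [hm, isLinearSymmetry_smul_iff hc] at h
    rw [isLinearSymmetry_iff] at h
    rw [integral_correlator_eq_zero μ _ _ h, linearTwirl_op_mul_of_not_isLinearSymmetry h']
    simp [hsInner]

theorem proposition2 {n : ℕ} (𝒢 : Set (PauliString n))
    [MeasurableSpace (dynamicalGroup 𝒢)] [BorelSpace (dynamicalGroup 𝒢)]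
    (μ : Measure (dynamicalGroup 𝒢)) [μ.IsHaarMeasure] [IsProbabilityMeasure μ]
    (P Q R S : PauliString n) :
    (∫ U : dynamicalGroup 𝒢,
        (P.op * (U : QubitOp n) * Q.op * (U : QubitOp n).conjTranspose *
          R.op * (U : QubitOp n) * S.op * (U : QubitOp n).conjTranspose).trace ∂μ
      = ((2 : ℂ) ^ n)⁻¹ * hsInner (R.op * P.op) (linearTwirl 𝒢 (S.op * Q.op)) *
          (1 - 2 * ({T ∈ graphComponent 𝒢 Q | P.op * T.op + T.op * P.op = 0}.ncard : ℂ) /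
            ((graphComponent 𝒢 Q).ncard : ℂ))) ∧
    ((¬ ∃ L : QubitOp n, IsLinearSymmetry 𝒢 L ∧
        (∃ a : ℂ, R.op * P.op = a • L) ∧ (∃ b : ℂ, Q.op * S.op = b • L)) →
      ∫ U : dynamicalGroup 𝒢,
        (P.op * (U : QubitOp n) * Q.op * (U : QubitOp n).conjTranspose *
          R.op * (U : QubitOp n) * S.op * (U : QubitOp n).conjTranspose).trace ∂μ = 0) := by
  have h := integral_correlator_eq 𝒢 μ P Q R S
  refine ⟨h, fun hne => h.trans ?_⟩
  have h0 : hsInner (R.op * P.op) (linearTwirl 𝒢 (S.op * Q.op)) = 0 :=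
    not_not.mp fun h0 => hne (exists_isLinearSymmetry_of_hsInner_linearTwirl_ne_zero h0)
  rw [h0, mul_zero, zero_mul]
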